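/- For a left noetherian ring $R$ let $\mathbf{K}^{-,b}(\operatorname{proj} R)$ be the homotopy category of bounded above complexes of finitely generated projective left $R$-modules with bounded cohomology, and let $\mathbf{K}^{b}(\operatorname{proj} R)$ be its full triangulated subcategory of perfect complexes, i.e. of those complexes that are homotopy equivalent to a bounded complex of finitely generated projective left $R$-modules. The singularity category of $R$ is the Verdier quotient $\mathbf{D}_{\mathrm{sg}}(R)=\mathbf{K}^{-,b}(\operatorname{proj} R)/\mathbf{K}^{b}(\operatorname{proj} R)$. Two left noetherian rings are called singularly equivalent if there is a triangle equivalence between their singularity categories. Let $T$ and $S$ be left noetherian rings and let $M$ be an $S$-$T$-bimodule such that ${}_SM$ is finitely generated. Assume that $T$ has finite left global dimension. Then the triangular matrix ring $\begin{pmatrix} T & 0\\ M & S\end{pmatrix}$ is left noetherian, and there is a triangle equivalence $$\mathbf{D}_{\mathrm{sg}}\begin{pmatrix} T & 0\\ M & S\end{pmatrix}\;\cong\;\mathbf{D}_{\mathrm{sg}}(S).$$ In particular, let $k$ be a field, $\Lambda$ a finite dimensional $k$-algebra and $M$ a finite dimensional left $\Lambda$-module, regarded as a $\Lambda$-$k$-bimodule.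 Then the one-point extension $\Lambda[M]=\begin{pmatrix} k & 0\\ M & \Lambda\end{pmatrix}$ is left noetherian, and it is singularly equivalent to $\Lambda$. -/

import Mathlib

open CategoryTheory CategoryTheory.Limits CategoryTheory.Pretriangulated MulOpposite
open scoped ZeroObject

universe u

/-! ### Triangular matrix rings -/

/-- The underlying set of the ring of matrices `[[t, 0], [m, s]]` with `t ∈ T`, `m ∈ M`, `s ∈ S`. -/
@[ext]
structure TriangularMatrixRing (T S M : Type u) : Type u where
  t : T
  m : M
  s : S

namespace TriangularMatrixRing

section AddCommGroup

variable {T S M : Type u} [Ring T] [Ring S] [AddCommGroup M]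

instance : Zero (TriangularMatrixRing T S M) := ⟨⟨0, 0, 0⟩⟩
instance : One (TriangularMatrixRing T S M) := ⟨⟨1, 0, 1⟩⟩
instance : Add (TriangularMatrixRing T S M) := ⟨fun a b => ⟨a.t + b.t, a.m + b.m, a.s + b.s⟩⟩
instance : Neg (TriangularMatrixRing T S M) := ⟨fun a => ⟨-a.t, -a.m, -a.s⟩⟩

@[simp] lemma zero_t : (0 : TriangularMatrixRing T S M).t = 0 := rfl
@[simp] lemma zero_m : (0 : TriangularMatrixRing T S M).m = 0 := rfl
@[simp] lemma zero_s : (0 : TriangularMatrixRing T S M).s = 0 := rfl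
@[simp] lemma one_t : (1 : TriangularMatrixRing T S M).t = 1 := rfl
@[simp] lemma one_m : (1 : TriangularMatrixRing T S M).m = 0 := rfl
@[simp] lemma one_s : (1 : TriangularMatrixRing T S M).s = 1 := rfl

section
variable (a b : TriangularMatrixRing T S M)
@[simp] lemma add_t : (a + b).t = a.t + b.t := rfl
@[simp] lemma add_m : (a + b).m = a.m + b.m := rfl
@[simp] lemma add_s : (a + b).s = a.s + b.s := rfl
@[simp] lemma neg_t : (-a).t = -a.t := rfl
@[simp] lemma neg_m : (-a).m = -a.m := rfl
@[simp] lemma neg_s : (-a).s = -a.s := rfl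
end

end AddCommGroup

variable {T S M : Type u} [Ring T] [Ring S] [AddCommGroup M]
  [Module S M] [Module Tᵐᵒᵖ M]

/-- Matrix multiplication
`[[t, 0], [m, s]] * [[t', 0], [m', s']] = [[t t', 0], [m t' + s m', s s']]`;
the right action of `t'` on `m` is written `op t' • m`. -/
instance : Mul (TriangularMatrixRing T S M) :=
  ⟨fun a b => ⟨a.t * b.t, op b.t • a.m + a.s • b.m, a.s * b.s⟩⟩

section
variable (a b : TriangularMatrixRing T S M)
@[simp] lemma mul_t : (a * b).t = a.t * b.t := rfl
@[simp] lemma mul_m : (a * b).m = op b.t • a.m + a.s • b.m := rfl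
@[simp] lemma mul_s : (a * b).s = a.s * b.s := rfl
end

/-- The triangular matrix ring `[[T, 0], [M, S]]` of an `S`-`T`-bimodule `M`. -/
instance [SMulCommClass S Tᵐᵒᵖ M] : Ring (TriangularMatrixRing T S M) where
  add_assoc _ _ _ := by ext <;> simp [add_assoc]
  zero_add _ := by ext <;> simp
  add_zero _ := by ext <;> simp
  add_comm _ _ := by ext <;> simp [add_comm]
  neg_add_cancel _ := by ext <;> simp
  nsmul := nsmulRec
  zsmul := zsmulRec
  mul_assoc a b c := by
    ext
    · simp [mul_assoc]
    · simp [mul_smul, smul_add, add_assoc, smul_comm]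
    · simp [mul_assoc]
  one_mul _ := by ext <;> simp
  mul_one _ := by ext <;> simp
  zero_mul _ := by ext <;> simp
  mul_zero _ := by ext <;> simp
  left_distrib a b c := by
    ext
    · simp [mul_add]
    · simp only [mul_m, add_t, add_m, MulOpposite.op_add, add_smul, smul_add]; abel
    · simp [mul_add]
  right_distrib a b c := by
    ext
    · simp [add_mul]
    · simp only [mul_m, add_s, add_m, add_smul, smul_add]; abel
    · simp [add_mul]

end TriangularMatrixRing

/-- The one-point extension `Λ[M] = [[k, 0], [M, Λ]]` of a `k`-algebra `Λ` by a left
`Λ`-module `M`, which is regarded as a `Λ`-`k`-bimodule through its `k`-vector space structure. -/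
def OnePointExtension (k Λ M : Type u) : Type u := TriangularMatrixRing k Λ M

/-- The right action of `k` on `M` is `m * c = c • m`. -/
instance (k Λ M : Type u) [Field k] [Ring Λ] [Algebra k Λ] [AddCommGroup M]
    [Module Λ M] [Module k M] [IsScalarTower k Λ M] : Ring (OnePointExtension k Λ M) :=
  letI : Module kᵐᵒᵖ M :=
    Module.compHom M ((RingHom.id k).fromOpposite (fun x y => mul_comm x y))
  letI : IsCentralScalar k M := ⟨fun _ _ => rfl⟩
  letI : SMulCommClass Λ k M := IsScalarTower.to_smulCommClass'
  inferInstanceAs (Ring (TriangularMatrixRing k Λ M))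

/-! ### Global dimension -/

/-- `T` has finite left global dimension: the projective dimensions of the left `T`-modules
are bounded. -/
def FiniteLeftGlobalDimension (T : Type u) [Ring T] : Prop :=
  ∃ d : ℕ, ∀ X : ModuleCat.{u} T, HasProjectiveDimensionLE X d

/-! ### Singularity categories -/

section

variable (R : Type u) [Ring R]

/-- Complexes of finitely generated projective left `R`-modules. -/
def IsFGProjComplex (K : CochainComplex (ModuleCat.{u} R) ℤ) : Prop :=
  ∀ n : ℤ, Module.Finite R (K.X n) ∧ Module.Projective R (K.X n)

/-- `K⁻(proj R)` as a full subcategory of the homotopy category of complexes of left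
`R`-modules: bounded above complexes of finitely generated projective modules. -/
def kMinusProj : ObjectProperty (HomotopyCategory (ModuleCat.{u} R) (ComplexShape.up ℤ)) :=
  fun K => IsFGProjComplex R K.as ∧ ∃ b : ℤ, ∀ n > b, IsZero (K.as.X n)

/-- Bounded complexes of finitely generated projective left `R`-modules. -/
def kBoundedProj : ObjectProperty (HomotopyCategory (ModuleCat.{u} R) (ComplexShape.up ℤ)) :=
  fun K => IsFGProjComplex R K.as ∧ (∃ b : ℤ, ∀ n > b, IsZero (K.as.X n)) ∧
    ∃ a : ℤ, ∀ n < a, IsZero (K.as.X n)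

/-- Complexes whose cohomology is bounded. -/
def boundedCohomology :
    ObjectProperty (HomotopyCategory (ModuleCat.{u} R) (ComplexShape.up ℤ)) :=
  fun K => ∃ a b : ℤ, ∀ n : ℤ, n < a ∨ b < n →
    IsZero ((HomotopyCategory.homologyFunctor (ModuleCat.{u} R) (ComplexShape.up ℤ) n).obj K)

/-- `K^{-,b}(proj R)`: bounded above complexes of finitely generated projective left
`R`-modules, with bounded cohomology. -/
abbrev kMinusBoundedProj :
    ObjectProperty (HomotopyCategory (ModuleCat.{u} R) (ComplexShape.up ℤ)) :=
  boundedCohomology R ⊓ kMinusProj R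

section Triangulated

variable {R}

lemma isFGProjComplex_mappingCone {K L : CochainComplex (ModuleCat.{u} R) ℤ} (f : K ⟶ L)
    (hK : IsFGProjComplex R K) (hL : IsFGProjComplex R L) :
    IsFGProjComplex R (CochainComplex.mappingCone f) := by
  intro n
  let e := (HomologicalComplex.homotopyCofiber.XIsoBiprod f n (n + 1) rfl ≪≫
    ModuleCat.biprodIsoProd _ _).toLinearEquiv
  have := (hK (n + 1)).1
  have := (hK (n + 1)).2
  have := (hL n).1
  have := (hL n).2
  exact ⟨Module.Finite.equiv e.symm, Module.Projective.of_equiv e.symm⟩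

lemma isZero_zero_X (n : ℤ) : IsZero ((0 : CochainComplex (ModuleCat.{u} R) ℤ).X n) :=
  Functor.map_isZero (HomologicalComplex.eval _ _ n) (isZero_zero _)

lemma isFGProjComplex_zero : IsFGProjComplex R 0 := by
  intro n
  have : Subsingleton ((0 : CochainComplex (ModuleCat.{u} R) ℤ).X n) :=
    ModuleCat.isZero_iff_subsingleton.1 (isZero_zero_X n)
  exact ⟨inferInstance, inferInstance⟩

/-- A property of complexes that holds for zero and is stable under shifts and mapping cones
defines a triangulated subcategory of the homotopy category. -/
lemma isTriangulated_of_mappingCone (Q : CochainComplex (ModuleCat.{u} R) ℤ → Prop)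
    (h₀ : Q 0) (hs : ∀ K (n : ℤ), Q K → Q (K⟦n⟧))
    (hc : ∀ (K L : CochainComplex (ModuleCat.{u} R) ℤ) (f : K ⟶ L), Q K → Q L →
      Q (CochainComplex.mappingCone f)) :
    ObjectProperty.IsTriangulated
      (fun K : HomotopyCategory (ModuleCat.{u} R) (ComplexShape.up ℤ) => Q K.as) := by
  let P : ObjectProperty (HomotopyCategory (ModuleCat.{u} R) (ComplexShape.up ℤ)) :=
    fun K => Q K.as
  have : P.ContainsZero :=
    ⟨(HomotopyCategory.quotient _ _).obj 0, Functor.map_isZero _ (isZero_zero _), h₀⟩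
  have : P.IsStableUnderShift ℤ := ⟨fun n => ⟨by
    intro K hK
    obtain ⟨K : CochainComplex _ _, rfl⟩ := K.quotient_obj_surjective
    rw [ObjectProperty.prop_shift_iff, HomotopyCategory.shift_quotient_obj]
    exact hs K n hK⟩⟩
  have : P.IsTriangulatedClosed₃ := ⟨fun T hT h₁ h₂ => by
    obtain ⟨f : T.obj₁.as ⟶ T.obj₂.as, hf⟩ :=
      (HomotopyCategory.quotient _ _).map_surjective T.mor₁
    exact ⟨_, hc _ _ f h₁ h₂, ⟨Triangle.π₃.mapIso (isoTriangleOfIso₁₂ T _ hT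
      (HomotopyCategory.mappingCone_triangleh_distinguished f)
        (Iso.refl _) (Iso.refl _) (by
          exact (Category.comp_id _).trans (hf.symm.trans (Category.id_comp _).symm)))⟩⟩⟩
  have : P.IsTriangulatedClosed₂ := .of_isTriangulatedClosed₃
  exact { (inferInstance : P.ContainsZero), (inferInstance : P.IsStableUnderShift ℤ),
    (inferInstance : P.IsTriangulatedClosed₂) with }

instance : (kMinusProj R).IsTriangulated :=
  isTriangulated_of_mappingCone
    (fun K => IsFGProjComplex R K ∧ ∃ b : ℤ, ∀ n > b, IsZero (K.X n))
    ⟨isFGProjComplex_zero, 0, fun n _ => isZero_zero_X n⟩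
    (fun _ i ⟨h, b, hb⟩ => ⟨fun n => h (n + i), b - i, fun n hn => hb (n + i) (by lia)⟩)
    (fun _ _ f ⟨hK, b, hb⟩ ⟨hL, b', hb'⟩ => ⟨isFGProjComplex_mappingCone f hK hL, max b b',
      fun n hn => (CochainComplex.mappingCone.isZero_X_iff f n).2
        ⟨hb (n + 1) (by lia), hb' n (by lia)⟩⟩)

instance : (kBoundedProj R).IsTriangulated :=
  isTriangulated_of_mappingCone
    (fun K => IsFGProjComplex R K ∧ (∃ b : ℤ, ∀ n > b, IsZero (K.X n)) ∧
      ∃ a : ℤ, ∀ n < a, IsZero (K.X n))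
    ⟨isFGProjComplex_zero, ⟨0, fun n _ => isZero_zero_X n⟩, 0, fun n _ => isZero_zero_X n⟩
    (fun _ i ⟨h, ⟨b, hb⟩, a, ha⟩ => ⟨fun n => h (n + i),
      ⟨b - i, fun n hn => hb (n + i) (by lia)⟩, a - i, fun n hn => ha (n + i) (by lia)⟩)
    (fun _ _ f ⟨hK, ⟨b, hb⟩, a, ha⟩ ⟨hL, ⟨b', hb'⟩, a', ha'⟩ =>
      ⟨isFGProjComplex_mappingCone f hK hL,
        ⟨max b b', fun n hn => (CochainComplex.mappingCone.isZero_X_iff f n).2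
          ⟨hb (n + 1) (by lia), hb' n (by lia)⟩⟩,
        min (a - 1) a', fun n hn => (CochainComplex.mappingCone.isZero_X_iff f n).2
          ⟨ha (n + 1) (by lia), ha' n (by lia)⟩⟩)

instance : (boundedCohomology R).IsClosedUnderIsomorphisms where
  of_iso e := by
    rintro ⟨a, b, h⟩
    exact ⟨a, b, fun n hn => (h n hn).of_iso (Functor.mapIso _ e.symm)⟩

instance : (boundedCohomology R).IsTriangulated where
  exists_zero := ⟨0, isZero_zero _, 0, 0, fun n _ => Functor.map_isZero _ (isZero_zero _)⟩
  isStableUnderShiftBy i := ⟨by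
    rintro K ⟨a, b, h⟩
    refine ⟨a - i, b - i, fun n hn => (h (i + n) (by lia)).of_iso ?_⟩
    exact ((HomotopyCategory.homologyFunctor (ModuleCat.{u} R) (ComplexShape.up ℤ) 0).shiftIso
      i n (i + n) rfl).app K⟩
  toIsTriangulatedClosed₂ := .mk' (by
    rintro T hT ⟨a, b, h⟩ ⟨a', b', h'⟩
    refine ⟨min a a', max b b', fun n hn => ?_⟩
    exact ((HomotopyCategory.homologyFunctor (ModuleCat.{u} R) (ComplexShape.up ℤ)
      n).map_distinguished_exact T hT).isZero_of_both_zeros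
      ((h n (by lia)).eq_of_src _ _) ((h' n (by lia)).eq_of_tgt _ _))

end Triangulated

/-- The perfect complexes in `K^{-,b}(proj R)`: those that are isomorphic, in the homotopy
category, to a bounded complex of finitely generated projective modules. -/
abbrev perfectComplexes : ObjectProperty (kMinusBoundedProj R).FullSubcategory :=
  (kBoundedProj R).isoClosure.inverseImage (kMinusBoundedProj R).ι

/-- The singularity category `D_sg(R)`: the Verdier quotient of `K^{-,b}(proj R)` by its
triangulated subcategory of perfect complexes, that is, the localization at the morphisms whose
cone is perfect. -/
abbrev SingularityCategory := (perfectComplexes R).trW.Localization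

end

/-- `R` and `S` are singularly equivalent: there is a triangle equivalence between their
singularity categories. -/
def SingularlyEquivalent (R S : Type u) [Ring R] [Ring S] : Prop :=
  ∃ (e : SingularityCategory R ≌ SingularityCategory S) (_ : e.functor.CommShift ℤ),
    e.functor.IsTriangulated

-- Write `A` for the triangular ring and `e = inT S M 1` for its upper left idempotent. Since `e A
-- (1 - e) = 0`, the ideal `A e A` equals `A e = [[T, 0], [M, 0]]`, with quotient ring `S`, and
-- every module `V` has a corner `eV` over `T`, a trace `A e V` and a quotient `V / A e V` over `S`.
-- As a left module `S` is the direct summand `A (1 - e)` of `A`, so inflation from `S` to `A`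
-- preserves finitely generated projectives; so does `V ↦ V / A e V`, and for projective `V` the
-- sequence `0 → A e V → V → V / A e V → 0` splits.
--
-- Inflation followed by the quotient is isomorphic to the identity. In the other direction, for `K`
-- in `K^{-,b}(proj A)` the cone of the projection of `K` onto its inflated quotient is a shift of
-- the trace complex, so the point is that the trace complex is perfect
-- (`isoClosure_kBoundedProj_traceComplex`). The corner complex consists of projective `T`-modules
-- and is exact in low degrees; finite global dimension forces it to split there
-- (`exists_isSplitAt_of_exactAt`). The contraction extends from the corners to the traces
-- (`exists_extend_corner`, `isSplitAt_traceComplex`), and a bounded above complex that splits in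
-- low degrees is homotopy equivalent to a truncation of itself
-- (`isoClosure_kBoundedProj_of_isSplitAt`). The two functors thus become mutually inverse on
-- Verdier quotients (`exists_triangleEquivalence_localization`).

set_option linter.unusedSectionVars false

-- Diagonal projections and corner elements.

namespace TriangularMatrixRing

variable {T S M : Type u} [Ring T] [Ring S] [AddCommGroup M]
  [Module S M] [Module Tᵐᵒᵖ M] [SMulCommClass S Tᵐᵒᵖ M]

variable (T S M) in
/-- The projection onto the lower right entry. -/
def toS : TriangularMatrixRing T S M →+* S where
  toFun a := a.s
  map_one' := rfl
  map_mul' _ _ := rfl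
  map_zero' := rfl
  map_add' _ _ := rfl

variable (T S M) in
/-- The projection onto the upper left entry. -/
def toT : TriangularMatrixRing T S M →+* T where
  toFun a := a.t
  map_one' := rfl
  map_mul' _ _ := rfl
  map_zero' := rfl
  map_add' _ _ := rfl

instance : RingHomSurjective (toS T S M) := ⟨fun s => ⟨⟨0, 0, s⟩, rfl⟩⟩

instance : RingHomSurjective (toT T S M) := ⟨fun t => ⟨⟨t, 0, 0⟩, rfl⟩⟩

variable (S M) in
/-- The upper left corner of the triangular matrix ring. -/
def inT (t : T) : TriangularMatrixRing T S M := ⟨t, 0, 0⟩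

variable (T M) in
/-- The lower right corner of the triangular matrix ring. -/
def inS (s : S) : TriangularMatrixRing T S M := ⟨0, 0, s⟩

lemma inT_one_mul (a : TriangularMatrixRing T S M) : inT S M 1 * a = inT S M a.t := by
  ext <;> simp [inT]

lemma inT_mul_inT (t t' : T) : (inT S M t * inT S M t') = inT S M (t * t') := by
  ext <;> simp [inT]

lemma inT_add (t t' : T) : (inT S M (t + t')) = inT S M t + inT S M t' := by
  ext <;> simp [inT]

lemma inS_mul_inS (s s' : S) : (inS T M s * inS T M s') = inS T M (s * s') := by
  ext <;> simp [inS]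

lemma inS_add (s s' : S) : (inS T M (s + s')) = inS T M s + inS T M s' := by
  ext <;> simp [inS]

lemma inS_zero : inS T M (0 : S) = 0 := rfl

lemma mul_inS (a : TriangularMatrixRing T S M) (s : S) : a * inS T M s = inS T M (a.s * s) := by
  ext <;> simp [inS]

/-! ### The corner of a module -/

section Corner

variable (V W : Type*) [AddCommGroup V] [Module (TriangularMatrixRing T S M) V]
  [AddCommGroup W] [Module (TriangularMatrixRing T S M) W]

variable (T S M) in
/-- The elements of a module on which the idempotent `[[1, 0], [0, 0]]` acts as the identity. -/
def corner : AddSubgroup V where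
  carrier := {v | inT S M (1 : T) • v = v}
  zero_mem' := smul_zero _
  add_mem' {v w} hv hw := by
    simp only [Set.mem_ofPred_eq] at hv hw ⊢
    rw [smul_add, hv, hw]
  neg_mem' {v} hv := by
    simp only [Set.mem_ofPred_eq] at hv ⊢
    rw [smul_neg, hv]

variable {V W}

lemma mem_corner_iff {v : V} : v ∈ corner T S M V ↔ inT S M (1 : T) • v = v := Iff.rfl

variable (S M) in
lemma inT_smul_mem_corner (t : T) (v : V) : inT S M t • v ∈ corner T S M V := by
  rw [mem_corner_iff, smul_smul, inT_mul_inT, one_mul]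

lemma map_mem_corner (g : V →ₗ[TriangularMatrixRing T S M] W) {v : V}
    (hv : v ∈ corner T S M V) : g v ∈ corner T S M W := by
  rw [mem_corner_iff] at hv ⊢
  rw [← map_smul, hv]

instance : Module T (corner T S M V) where
  smul t v := ⟨inT S M t • (v : V), inT_smul_mem_corner S M t _⟩
  one_smul v := Subtype.ext v.2
  mul_smul t t' v := Subtype.ext (by
    change inT S M (t * t') • (v : V) = inT S M t • inT S M t' • (v : V)
    rw [smul_smul, inT_mul_inT])
  smul_zero t := Subtype.ext (smul_zero (inT S M t))
  smul_add t v w := Subtype.ext (smul_add (inT S M t) (v : V) w)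
  add_smul t t' v := Subtype.ext (by
    change inT S M (t + t') • (v : V) = inT S M t • (v : V) + inT S M t' • (v : V)
    rw [inT_add, add_smul])
  zero_smul v := Subtype.ext (zero_smul (TriangularMatrixRing T S M) (v : V))

lemma coe_smul_corner (t : T) (v : corner T S M V) :
    ((t • v : corner T S M V) : V) = inT S M t • (v : V) := rfl

/-- The restriction of a linear map to the corners. -/
def cornerMap (g : V →ₗ[TriangularMatrixRing T S M] W) :
    corner T S M V →ₗ[T] corner T S M W where
  toFun v := ⟨g v, map_mem_corner g v.2⟩
  map_add' v w := Subtype.ext (map_add g (v : V) w)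
  map_smul' t v := Subtype.ext (map_smul g (inT S M t) (v : V))

variable (T S M) in
/-- The projection of a module onto its corner. -/
def toCorner (v : V) : corner T S M V := ⟨inT S M (1 : T) • v, inT_smul_mem_corner S M 1 v⟩

lemma toCorner_smul (a : TriangularMatrixRing T S M) (v : V) :
    toCorner T S M (a • v) = a.t • toCorner T S M v := Subtype.ext (by
  change inT S M (1 : T) • a • v = inT S M a.t • inT S M (1 : T) • v
  rw [smul_smul, smul_smul, inT_one_mul, inT_mul_inT, mul_one])

lemma toCorner_add (v w : V) :
    toCorner T S M (v + w) = toCorner T S M v + toCorner T S M w :=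
  Subtype.ext (smul_add _ _ _)

lemma toCorner_coe (v : corner T S M V) : toCorner T S M (v : V) = v := Subtype.ext v.2

/-- A linear map between the corners of two modules extends to a linear map if the source is
projective. -/
lemma exists_extend_corner [Module.Projective (TriangularMatrixRing T S M) V]
    (φ : corner T S M V →ₗ[T] corner T S M W) :
    ∃ ψ : V →ₗ[TriangularMatrixRing T S M] W, ∀ v : corner T S M V, ψ v = φ v := by
  obtain ⟨s, hs⟩ := (inferInstance : Module.Projective (TriangularMatrixRing T S M) V)
  -- With `s` a section of the free cover of `V`, the map `ψ` applies `s` and then sends the basis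
  -- vector at `p` to `φ (e p)`.
  refine ⟨(Finsupp.linearCombination _ (fun p : V => (φ (toCorner T S M p) : W))).comp s,
    fun v => ?_⟩
  have h₁ : s v = inT S M (1 : T) • s v := by rw [← map_smul, v.2]
  -- On the corner the coefficients of `s v` are fixed by left multiplication by `e`, hence lie in
  -- `e A = T`, where the `T`-linearity of `φ` applies.
  have h₂ : ∀ p : V, s v p = inT S M (s v p).t := fun p => by
    conv_lhs => rw [h₁, Finsupp.smul_apply, smul_eq_mul, inT_one_mul]
  have h₃ : v = (s v).sum fun p a => a.t • toCorner T S M p := by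
    conv_lhs => rw [← toCorner_coe v, ← hs (v : V), Finsupp.linearCombination_apply, Finsupp.sum]
    rw [Finsupp.sum]
    refine Subtype.ext ?_
    simp [toCorner, Finset.smul_sum, coe_smul_corner, smul_smul, inT_one_mul, inT_mul_inT]
  conv_rhs => rw [h₃, Finsupp.sum, map_sum]
  rw [LinearMap.comp_apply, Finsupp.linearCombination_apply, Finsupp.sum,
    AddSubgroup.val_finsetSum]
  refine Finset.sum_congr rfl fun p _ => ?_
  rw [map_smul, coe_smul_corner, ← h₂]

/-- Because `e a = a.t e`, the map `v ↦ e v` is linear from `V` onto its corner with `A` acting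
through `T`. Lifting it along a surjection of `T`-modules and restricting the lift to the corner
gives the required section. -/
lemma projective_corner {V : Type u} [AddCommGroup V] [Module (TriangularMatrixRing T S M) V]
    [Module.Projective (TriangularMatrixRing T S M) V] :
    Module.Projective T (corner T S M V) := by
  refine Module.Projective.of_lifting_property'' fun g hg => ?_
  let N := (corner T S M V →₀ T)
  let _ : Module (TriangularMatrixRing T S M) N := Module.compHom N (toT T S M)
  let _ : Module (TriangularMatrixRing T S M) (corner T S M V) := Module.compHom _ (toT T S M)
  let g' : N →ₗ[TriangularMatrixRing T S M] corner T S M V :=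
    { toFun := g
      map_add' := map_add g
      map_smul' a v := map_smul g a.t v }
  let p : V →ₗ[TriangularMatrixRing T S M] corner T S M V :=
    { toFun := toCorner T S M
      map_add' := toCorner_add
      map_smul' := toCorner_smul }
  obtain ⟨h, hh⟩ := Module.projective_lifting_property g' p hg
  refine ⟨{ toFun v := h v, map_add' v w := map_add h (v : V) w, map_smul' t v :=
    map_smul h (inT S M t) (v : V) }, ?_⟩
  ext1 v
  exact (LinearMap.congr_fun hh (v : V)).trans (toCorner_coe v)

end Corner

/-! ### The trace submodule and the quotient by it -/

section Trace

variable (V W : Type*) [AddCommGroup V] [Module (TriangularMatrixRing T S M) V]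
  [AddCommGroup W] [Module (TriangularMatrixRing T S M) W]

variable (T S M) in
/-- The submodule generated by the corner of a module. -/
def trace : Submodule (TriangularMatrixRing T S M) V :=
  Submodule.span _ (corner T S M V : Set V)

variable {V W}

lemma corner_le_trace {v : V} (hv : v ∈ corner T S M V) : v ∈ trace T S M V :=
  Submodule.subset_span hv

/-- The elements with `a.s = 0` form the ideal `A e`, so `a v = a (e v)`. -/
lemma smul_mem_trace {a : TriangularMatrixRing T S M} (ha : a.s = 0) (v : V) :
    a • v ∈ trace T S M V := by
  have : a = a * inT S M (1 : T) := by ext <;> simp [inT, ha]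
  rw [this, mul_smul]
  exact Submodule.smul_mem _ _ (corner_le_trace (inT_smul_mem_corner S M 1 v))

lemma map_mem_trace (g : V →ₗ[TriangularMatrixRing T S M] W) {v : V}
    (hv : v ∈ trace T S M V) : g v ∈ trace T S M W := by
  have : trace T S M V ≤ (trace T S M W).comap g :=
    Submodule.span_le.2 fun v hv => corner_le_trace (map_mem_corner g hv)
  exact this hv

variable (T S M V) in
/-- The quotient of a module by the submodule generated by its corner; this is the largest quotient
on which the ideal `[[T, 0], [M, 0]]` vanishes. -/
def TraceQuotient : Type _ := V ⧸ trace T S M V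

namespace TraceQuotient

instance : AddCommGroup (TraceQuotient T S M V) :=
  inferInstanceAs (AddCommGroup (V ⧸ trace T S M V))

/-- The projection onto the quotient by the submodule generated by the corner, as an additive
map. -/
def mkAddHom : V →+ TraceQuotient T S M V := (trace T S M V).mkQ.toAddMonoidHom

lemma mkAddHom_surjective : Function.Surjective (mkAddHom : V →+ TraceQuotient T S M V) :=
  Submodule.Quotient.mk_surjective _

lemma mkAddHom_eq_zero_iff (v : V) :
    (mkAddHom v : TraceQuotient T S M V) = 0 ↔ v ∈ trace T S M V :=
  Submodule.Quotient.mk_eq_zero _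

lemma mkAddHom_smul_eq {a b : TriangularMatrixRing T S M} (h : a.s = b.s) (v : V) :
    (mkAddHom (a • v) : TraceQuotient T S M V) = mkAddHom (b • v) := by
  rw [← sub_eq_zero, ← map_sub, mkAddHom_eq_zero_iff, ← sub_smul]
  exact smul_mem_trace (by simp [sub_eq_add_neg, h]) v

instance : SMul S (TraceQuotient T S M V) where
  smul s q := show V ⧸ trace T S M V from inS T M s • (show V ⧸ trace T S M V from q)

lemma smul_mkAddHom (s : S) (v : V) :
    s • (mkAddHom v : TraceQuotient T S M V) = mkAddHom (inS T M s • v) := rfl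

instance : Module S (TraceQuotient T S M V) where
  one_smul q := by
    obtain ⟨v, rfl⟩ := mkAddHom_surjective q
    -- `inS T M 1` need not be the unit of the ring, but it has the same lower right entry, which is
    -- all that acts on the quotient.
    rw [smul_mkAddHom, mkAddHom_smul_eq (a := inS T M (1 : S)) (b := 1) rfl, one_smul]
  mul_smul s s' q := by
    obtain ⟨v, rfl⟩ := mkAddHom_surjective q
    rw [smul_mkAddHom, smul_mkAddHom, smul_mkAddHom, smul_smul, inS_mul_inS]
  smul_zero s := by
    rw [← map_zero (mkAddHom (V := V)), smul_mkAddHom, smul_zero]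
  smul_add s q q' := by
    obtain ⟨v, rfl⟩ := mkAddHom_surjective q
    obtain ⟨v', rfl⟩ := mkAddHom_surjective q'
    rw [← map_add, smul_mkAddHom, smul_mkAddHom, smul_mkAddHom, smul_add, map_add]
  add_smul s s' q := by
    obtain ⟨v, rfl⟩ := mkAddHom_surjective q
    rw [smul_mkAddHom, smul_mkAddHom, smul_mkAddHom, inS_add, add_smul, map_add]
  zero_smul q := by
    obtain ⟨v, rfl⟩ := mkAddHom_surjective q
    rw [smul_mkAddHom, inS_zero, zero_smul, map_zero]

variable (T S M V) in
/-- The projection onto the quotient by the submodule generated by the corner. -/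
def mk : V →ₛₗ[toS T S M] TraceQuotient T S M V where
  toFun := mkAddHom
  map_add' := map_add _
  map_smul' a v := mkAddHom_smul_eq (a := a) (b := inS T M a.s) rfl v

lemma mk_surjective : Function.Surjective (mk T S M V) := mkAddHom_surjective

lemma mk_eq_zero_iff (v : V) : mk T S M V v = 0 ↔ v ∈ trace T S M V := mkAddHom_eq_zero_iff v

section Desc

variable {N : Type*} [AddCommGroup N] [Module S N]

lemma trace_le_ker (g : V →ₛₗ[toS T S M] N) : trace T S M V ≤ LinearMap.ker g :=
  Submodule.span_le.2 fun v hv => by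
    rw [SetLike.mem_coe, LinearMap.mem_ker, ← mem_corner_iff.1 hv, map_smulₛₗ]
    exact zero_smul S _

/-- The universal property of the quotient by the submodule generated by the corner. -/
def desc (g : V →ₛₗ[toS T S M] N) : TraceQuotient T S M V →ₗ[S] N where
  toFun := QuotientAddGroup.lift (trace T S M V).toAddSubgroup g.toAddMonoidHom
    fun _ hv => trace_le_ker g hv
  map_add' := map_add _
  map_smul' s q := by
    obtain ⟨v, rfl⟩ := mk_surjective q
    exact map_smulₛₗ g (inS T M s) v

end Desc

/-- The linear map induced on the quotients by the submodules generated by the corners. -/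
def map (g : V →ₗ[TriangularMatrixRing T S M] W) :
    TraceQuotient T S M V →ₗ[S] TraceQuotient T S M W :=
  desc ((mk T S M W).comp g)

variable (T S M V) in
lemma finite [Module.Finite (TriangularMatrixRing T S M) V] :
    Module.Finite S (TraceQuotient T S M V) :=
  Module.Finite.of_surjective (mk T S M V) mk_surjective

variable (T S M V) in
-- A surjection of `S`-modules is inflated to the triangular ring, the projection from `V` is lifted
-- along it, and the lift descends by `desc`.
lemma projective [Module.Projective (TriangularMatrixRing T S M) V] :
    Module.Projective S (TraceQuotient T S M V) := by
  refine Module.Projective.of_lifting_property'' fun g hg => ?_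
  let N := TraceQuotient T S M V →₀ S
  let _ : Module (TriangularMatrixRing T S M) N := Module.compHom N (toS T S M)
  let _ : Module (TriangularMatrixRing T S M) (TraceQuotient T S M V) :=
    Module.compHom _ (toS T S M)
  let g' : N →ₗ[TriangularMatrixRing T S M] TraceQuotient T S M V :=
    { toFun := g
      map_add' := map_add g
      map_smul' a v := map_smul g a.s v }
  let p : V →ₗ[TriangularMatrixRing T S M] TraceQuotient T S M V :=
    { toFun := mk T S M V
      map_add' := map_add _
      map_smul' := (mk T S M V).map_smulₛₗ }
  obtain ⟨h, hh⟩ := Module.projective_lifting_property g' p hg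
  let h' : V →ₛₗ[toS T S M] N :=
    { toFun := h
      map_add' := map_add h
      map_smul' := map_smul h }
  refine ⟨desc h', ?_⟩
  ext1 q
  obtain ⟨v, rfl⟩ := mk_surjective q
  exact LinearMap.congr_fun hh v

end TraceQuotient

/-! ### Inflation of modules over the lower right entry -/

section Inflation

variable (N : Type*) [AddCommGroup N] [Module S N] [Module (TriangularMatrixRing T S M) N]

variable (T M) in
-- The second column of the ring is a direct summand, isomorphic to `S`. The action is an arbitrary
-- instance subject to `h`, so that the result is not tied to one construction of it.
lemma projective_self_of_smul_eq [Module (TriangularMatrixRing T S M) S]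
    (h : ∀ (a : TriangularMatrixRing T S M) (s : S), a • s = a.s * s) :
    Module.Projective (TriangularMatrixRing T S M) S :=
  Module.Projective.of_split (M := TriangularMatrixRing T S M)
    { toFun s := inS T M s
      map_add' := inS_add
      map_smul' a s := by rw [h]; exact (mul_inS a s).symm }
    { toFun a := a.s
      map_add' _ _ := rfl
      map_smul' a b := (h a b.s).symm } rfl

lemma projective_of_smul_eq [Module.Projective S N]
    (h : ∀ (a : TriangularMatrixRing T S M) (v : N), a • v = a.s • v) :
    Module.Projective (TriangularMatrixRing T S M) N := by
  obtain ⟨s, hs⟩ := (inferInstance : Module.Projective S N)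
  let _ : Module (TriangularMatrixRing T S M) S := Module.compHom S (toS T S M)
  have := projective_self_of_smul_eq T M (S := S) fun _ _ => rfl
  classical
  have : Module.Projective (TriangularMatrixRing T S M) (N →₀ S) :=
    Module.Projective.of_equiv' (finsuppLequivDFinsupp (TriangularMatrixRing T S M)).symm
  refine Module.Projective.of_split (M := N →₀ S)
    { toFun v := s v
      map_add' := map_add s
      map_smul' a v := by rw [h]; exact map_smul s a.s v }
    { toFun v := Finsupp.linearCombination S (id : N → N) v
      map_add' := map_add _
      map_smul' a v :=
        (map_smul (Finsupp.linearCombination S (id : N → N)) a.s v).trans (h a _).symm } ?_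
  ext v
  exact hs v

end Inflation

end Trace

end TriangularMatrixRing

namespace TriangularMatrixRing

variable (T S M : Type u) [Ring T] [Ring S] [AddCommGroup M]
  [Module S M] [Module Tᵐᵒᵖ M] [SMulCommClass S Tᵐᵒᵖ M]

/-! ### Noetherianness -/

/-- The triangular matrix ring of a bimodule that is finitely generated over the lower right
entry is left noetherian if both diagonal entries are. -/
theorem isNoetherianRing [IsNoetherianRing T] [IsNoetherianRing S] [Module.Finite S M] :
    IsNoetherianRing (TriangularMatrixRing T S M) := by
  -- The second row `[[0, 0], [M, S]]` is a left ideal on which the ring acts through `S`, and the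
  -- quotient by it is `T`; the ring is an extension of these two noetherian modules.
  let _ : Module (TriangularMatrixRing T S M) (M × S) := Module.compHom _ (toS T S M)
  let _ : Module (TriangularMatrixRing T S M) T := Module.compHom _ (toT T S M)
  have h₁ : IsNoetherian (TriangularMatrixRing T S M) (M × S) :=
    (LinearMap.isNoetherian_iff_of_bijective (σ := toS T S M)
      { toFun := id, map_add' _ _ := rfl, map_smul' _ _ := rfl } Function.bijective_id).2
      inferInstance
  have h₂ : IsNoetherian (TriangularMatrixRing T S M) T :=
    (LinearMap.isNoetherian_iff_of_bijective (σ := toT T S M)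
      { toFun := id, map_add' _ _ := rfl, map_smul' _ _ := rfl } Function.bijective_id).2
      inferInstance
  refine isNoetherian_of_range_eq_ker (M := M × S) (P := T)
    { toFun x := ⟨0, x.1, x.2⟩
      map_add' _ _ := by ext <;> simp
      map_smul' a x := by
        ext
        · simp
        · simp only [RingHom.id_apply, smul_eq_mul, mul_m, MulOpposite.op_zero, zero_smul, zero_add]
          rfl
        · rfl }
    { toFun a := a.t
      map_add' _ _ := rfl
      map_smul' _ _ := rfl } ?_
  ext a
  constructor
  · rintro ⟨x, rfl⟩
    rfl
  · intro ha
    exact ⟨(a.m, a.s), TriangularMatrixRing.ext (Eq.symm ha) rfl rfl⟩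

/-! ### Functors between module categories -/

/-- The functor that sends a module to its corner. -/
def cornerFunctor : ModuleCat.{u} (TriangularMatrixRing T S M) ⥤ ModuleCat.{u} T where
  obj V := ModuleCat.of T (corner T S M V)
  map g := ModuleCat.ofHom (cornerMap g.hom)
  map_id _ := rfl
  map_comp _ _ := rfl

instance : (cornerFunctor T S M).Additive where
  map_add := rfl

/-- The functor that sends a module to the submodule generated by its corner. -/
def traceFunctor :
    ModuleCat.{u} (TriangularMatrixRing T S M) ⥤ ModuleCat.{u} (TriangularMatrixRing T S M) where
  obj V := ModuleCat.of _ (trace T S M V)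
  map g := ModuleCat.ofHom (g.hom.restrict fun _ => map_mem_trace g.hom)
  map_id _ := rfl
  map_comp _ _ := rfl

instance : (traceFunctor T S M).Additive where
  map_add := rfl

/-- The functor that sends a module to the largest quotient on which the ideal
`[[T, 0], [M, 0]]` vanishes, regarded as a module over the lower right entry. -/
def quotientFunctor : ModuleCat.{u} (TriangularMatrixRing T S M) ⥤ ModuleCat.{u} S where
  obj V := ModuleCat.of S (TraceQuotient T S M V)
  map g := ModuleCat.ofHom (TraceQuotient.map g.hom)
  map_id _ := by
    ext q
    obtain ⟨v, rfl⟩ := TraceQuotient.mk_surjective q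
    rfl
  map_comp _ _ := by
    ext q
    obtain ⟨v, rfl⟩ := TraceQuotient.mk_surjective q
    rfl

instance : (quotientFunctor T S M).Additive where
  map_add {_ _ _ _} := by
    ext q
    obtain ⟨v, rfl⟩ := TraceQuotient.mk_surjective q
    rfl

/-- Modules over the lower right entry as modules over the triangular matrix ring. -/
noncomputable abbrev inflation : ModuleCat.{u} S ⥤ ModuleCat.{u} (TriangularMatrixRing T S M) :=
  ModuleCat.restrictScalars (toS T S M)

/-- The inclusion of the submodule generated by the corner. -/
def traceι : traceFunctor T S M ⟶ 𝟭 _ where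
  app V := ModuleCat.ofHom (trace T S M V).subtype

/-- The projection onto the quotient by the submodule generated by the corner. -/
noncomputable def quotientπ : 𝟭 _ ⟶ quotientFunctor T S M ⋙ inflation T S M where
  app V := ModuleCat.ofHom (Y := (inflation T S M).obj ((quotientFunctor T S M).obj V))
    { toFun := TraceQuotient.mk T S M V
      map_add' := map_add _
      map_smul' := (TraceQuotient.mk T S M V).map_smulₛₗ }

lemma trace_inflation (N : ModuleCat.{u} S) : trace T S M ((inflation T S M).obj N) = ⊥ := by
  refine Submodule.span_eq_bot.2 fun v hv => ?_
  rw [← (mem_corner_iff (T := T) (S := S) (M := M)).1 hv]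
  exact zero_smul S (v : N)

/-- The projection of an inflated module onto its quotient by the submodule generated by its
corner. -/
noncomputable def inflationQuotientHom : 𝟭 _ ⟶ inflation T S M ⋙ quotientFunctor T S M where
  app N := ModuleCat.ofHom (Y := (quotientFunctor T S M).obj ((inflation T S M).obj N))
    { toFun v := TraceQuotient.mk T S M ((inflation T S M).obj N) v
      map_add' := map_add (TraceQuotient.mk T S M ((inflation T S M).obj N))
      map_smul' s := (TraceQuotient.mk T S M ((inflation T S M).obj N)).map_smulₛₗ (inS T M s) }

instance (N : ModuleCat.{u} S) : IsIso ((inflationQuotientHom T S M).app N) := by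
  rw [ConcreteCategory.isIso_iff_bijective]
  constructor
  · refine (injective_iff_map_eq_zero ((inflationQuotientHom T S M).app N).hom).2 fun v hv => ?_
    have h := (TraceQuotient.mk_eq_zero_iff (T := T) (M := M)
      (V := (inflation T S M).obj N) v).1 hv
    rw [trace_inflation] at h
    exact h
  · exact TraceQuotient.mk_surjective (T := T) (M := M) (V := (inflation T S M).obj N)

lemma projective_inflation (N : ModuleCat.{u} S) [Module.Projective S N] :
    Module.Projective (TriangularMatrixRing T S M) ((inflation T S M).obj N) :=
  let _ : Module S ((inflation T S M).obj N) := N.isModule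
  have : Module.Projective S ((inflation T S M).obj N) := ‹Module.Projective S N›
  projective_of_smul_eq _ fun _ _ => rfl

lemma finite_inflation (N : ModuleCat.{u} S) [Module.Finite S N] :
    Module.Finite (TriangularMatrixRing T S M) ((inflation T S M).obj N) :=
  (LinearMap.finite_iff_of_bijective
    ({ toFun v := v, map_add' _ _ := rfl, map_smul' _ _ := rfl } :
      (inflation T S M).obj N →ₛₗ[toS T S M] N) Function.bijective_id).2 ‹_›

variable {T S M}

/-- The sequence `0 ⟶ trace V ⟶ V ⟶ V ⧸ trace V ⟶ 0`. -/
noncomputable def traceSequence (V : ModuleCat.{u} (TriangularMatrixRing T S M)) :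
    ShortComplex (ModuleCat.{u} (TriangularMatrixRing T S M)) where
  f := (traceι T S M).app V
  g := (quotientπ T S M).app V
  zero := by
    ext v
    exact (TraceQuotient.mk_eq_zero_iff _).2 v.2

lemma traceSequence_shortExact (V : ModuleCat.{u} (TriangularMatrixRing T S M)) :
    (traceSequence V).ShortExact where
  exact := by
    rw [ShortComplex.moduleCat_exact_iff]
    intro v hv
    exact ⟨(⟨v, (TraceQuotient.mk_eq_zero_iff (T := T) (S := S) (M := M) (V := V) v).1 hv⟩ :
      trace T S M V), rfl⟩
  mono_f := (ModuleCat.mono_iff_injective _).2 (Subtype.val_injective (p := (· ∈ trace T S M V)))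
  epi_g := (ModuleCat.epi_iff_surjective _).2 (TraceQuotient.mk_surjective (V := V))

/-- For a projective module `V` the sequence `0 ⟶ trace V ⟶ V ⟶ V ⧸ trace V ⟶ 0` splits. -/
noncomputable def traceSequenceSplitting (V : ModuleCat.{u} (TriangularMatrixRing T S M))
    [Module.Projective (TriangularMatrixRing T S M) V] : (traceSequence V).Splitting :=
  -- The sequence splits because its right-hand term is projective over `S`, hence also after
  -- inflation.
  have := TraceQuotient.projective T S M V
  have : Module.Projective S ((quotientFunctor T S M).obj V) := this
  have := projective_inflation T S M ((quotientFunctor T S M).obj V)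
  have : Projective (traceSequence V).X₃ :=
    ModuleCat.projective_of_categoryTheory_projective
      ((inflation T S M).obj ((quotientFunctor T S M).obj V))
  (traceSequence_shortExact V).splittingOfProjective

lemma trace_fg_projective (V : ModuleCat.{u} (TriangularMatrixRing T S M))
    [Module.Finite (TriangularMatrixRing T S M) V]
    [Module.Projective (TriangularMatrixRing T S M) V] :
    Module.Finite (TriangularMatrixRing T S M) (trace T S M V) ∧
      Module.Projective (TriangularMatrixRing T S M) (trace T S M V) := by
  let r : V →ₗ[TriangularMatrixRing T S M] trace T S M V := (traceSequenceSplitting V).r.hom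
  have h : r ∘ₗ (trace T S M V).subtype = LinearMap.id :=
    (ModuleCat.hom_ext_iff.1 (traceSequenceSplitting V).f_r :)
  exact ⟨Module.Finite.of_surjective r (LinearMap.surjective_of_comp_eq_id _ _ h),
    Module.Projective.of_split _ _ h⟩

end TriangularMatrixRing

namespace CochainComplex

/-! ### Complexes that split locally -/

section

variable {C : Type*} [Category* C] [Preadditive C]

/-- A cochain complex is split at `n` if its identity is homotopic to zero in degree `n`. -/
def IsSplitAt (K : CochainComplex C ℤ) (n : ℤ) : Prop :=
  ∃ (h : K.X n ⟶ K.X (n - 1)) (h' : K.X (n + 1) ⟶ K.X n),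
    h ≫ K.d (n - 1) n + K.d n (n + 1) ≫ h' = 𝟙 (K.X n)

end

variable {C : Type*} [Category* C] [Abelian C] {K : CochainComplex C ℤ}

lemma opcycles_exact (K : CochainComplex C ℤ) (n : ℤ) :
    (ShortComplex.mk (K.d (n - 1) n) (K.pOpcycles n) (by simp)).Exact :=
  ShortComplex.exact_of_g_is_cokernel _ (K.opcyclesIsCokernel (n - 1) n (by simp))

/-- The sequence `0 ⟶ opcycles n ⟶ X (n + 1) ⟶ opcycles (n + 1) ⟶ 0`. -/
noncomputable abbrev opcyclesSequence (K : CochainComplex C ℤ) (n : ℤ) : ShortComplex C where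
  f := K.fromOpcycles n (n + 1)
  g := K.pOpcycles (n + 1)
  zero := by simp [← cancel_epi (K.pOpcycles n)]

/-- Opcycles are the cokernel of the incoming differential; exactness at `n` says precisely that the
outgoing one is injective on them. -/
lemma opcyclesSequence_shortExact {n : ℤ} (h : K.ExactAt n) :
    (opcyclesSequence K n).ShortExact where
  exact := by
    let φ : ShortComplex.mk (K.d n (n + 1)) (K.pOpcycles (n + 1)) (by simp) ⟶
        opcyclesSequence K n :=
      { τ₁ := K.pOpcycles n
        τ₂ := 𝟙 _
        τ₃ := 𝟙 _
        comm₁₂ := (K.p_fromOpcycles n (n + 1)).trans (Category.comp_id _).symm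
        comm₂₃ := (Category.id_comp _).trans (Category.comp_id _).symm }
    have : Epi φ.τ₁ := inferInstanceAs (Epi (K.pOpcycles n))
    have : IsIso φ.τ₂ := inferInstanceAs (IsIso (𝟙 _))
    have : Mono φ.τ₃ := inferInstanceAs (Mono (𝟙 _))
    rw [← ShortComplex.exact_iff_of_epi_of_isIso_of_mono φ]
    exact ShortComplex.exact_of_g_is_cokernel _ (K.opcyclesIsCokernel n (n + 1) (by simp))
  mono_f := by
    rw [K.exactAt_iff' (n - 1) n (n + 1) (by simp) (by simp)] at h
    have := h.mono_fromOpcycles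
    rw [show (opcyclesSequence K n).f = _ from
      ((Iso.inv_comp_eq _).1 (K.opcyclesIsoSc'_inv_fromOpcycles (n - 1) n (n + 1)
        (by simp) (by simp)))]
    exact mono_comp' inferInstance this
  epi_g := inferInstanceAs (Epi (K.pOpcycles (n + 1)))

/-- The opcycles at `n` are a summand of `X (n + 1)`, so they are projective and the projection from
`X n` has a section `s`. The outgoing part of the contraction recovers `pOpcycles n ≫ s`; the
complementary endomorphism dies in the opcycles and so lifts through the incoming differential. -/
lemma isSplitAt_of_projective_opcycles {n : ℤ} [Projective (K.X n)] (h : K.ExactAt n)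
    [Projective (K.X (n + 1))] [Projective (K.opcycles (n + 1))] : K.IsSplitAt n := by
  have hS := opcyclesSequence_shortExact h
  have : Projective (opcyclesSequence K n).X₃ := ‹Projective (K.opcycles (n + 1))›
  let σ := hS.splittingOfProjective
  let r : K.X (n + 1) ⟶ K.opcycles n := σ.r
  have hr : K.fromOpcycles n (n + 1) ≫ r = 𝟙 _ := σ.f_r
  have : Projective (K.opcycles n) :=
    Retract.projective (Y := K.X (n + 1)) ⟨K.fromOpcycles n (n + 1), r, hr⟩
  let s := Projective.factorThru (𝟙 (K.opcycles n)) (K.pOpcycles n)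
  have hs : s ≫ K.pOpcycles n = 𝟙 _ := Projective.factorThru_comp _ _
  have hz : (𝟙 _ - K.pOpcycles n ≫ s) ≫ K.pOpcycles n = 0 := by
    simp [Preadditive.sub_comp, hs]
  refine ⟨(opcycles_exact K n).liftFromProjective _ hz, r ≫ s, ?_⟩
  have h₁ := (opcycles_exact K n).liftFromProjective_comp _ hz
  dsimp at h₁
  have h₂ : K.d n (n + 1) ≫ r ≫ s = K.pOpcycles n ≫ s := by
    rw [← K.p_fromOpcycles n (n + 1), Category.assoc, reassoc_of% hr]
  rw [h₁, h₂, sub_add_cancel]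

lemma IsSplitAt.exactAt {n : ℤ} (h : K.IsSplitAt n) : K.ExactAt n := by
  obtain ⟨h, h', H⟩ := h
  rw [K.exactAt_iff' (n - 1) n (n + 1) (by simp) (by simp),
    ShortComplex.exact_iff_exact_up_to_refinements]
  intro A (x : A ⟶ K.X n) (hx : x ≫ K.d n (n + 1) = 0)
  refine ⟨A, 𝟙 _, inferInstance, x ≫ h, ?_⟩
  change 𝟙 A ≫ x = (x ≫ h) ≫ K.d (n - 1) n
  have := x ≫= H
  rw [Preadditive.comp_add, reassoc_of% hx, zero_comp, add_zero, Category.comp_id] at this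
  rw [Category.id_comp, Category.assoc, this]

/-- If a complex is split at `n`, its opcycles are a retract of its component in degree `n`. -/
lemma IsSplitAt.nonempty_retract {n : ℤ} (h : K.IsSplitAt n) :
    Nonempty (Retract (K.opcycles n) (K.X n)) := by
  obtain ⟨h, h', H⟩ := h
  refine ⟨⟨K.fromOpcycles n (n + 1) ≫ h', K.pOpcycles n, ?_⟩⟩
  rw [← cancel_epi (K.pOpcycles n), Category.comp_id, Category.assoc, K.p_fromOpcycles_assoc]
  have := H =≫ K.pOpcycles n
  simpa [Preadditive.add_comp] using this

/-- In a complex of projective objects that is exact in low degrees, the opcycles in low degrees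
are projective if all objects have bounded projective dimension. -/
lemma projective_opcycles_of_exactAt [∀ n, Projective (K.X n)] {a : ℤ} {d : ℕ}
    (ha : ∀ n < a, K.ExactAt n) (hd : ∀ X : C, HasProjectiveDimensionLE X d) (n : ℤ)
    (hn : n ≤ a - d) : Projective (K.opcycles n) := by
  -- Dimension shifting: each step to the left lowers the bound on the projective dimension by one,
  -- from `d` down to `0`. The strict bound `d - k + 1` means dimension at most `d - k`; truncated
  -- subtraction is harmless, as the bound then stays at projectivity.
  have key (k : ℕ) : ∀ n : ℤ, n ≤ a - k →
      HasProjectiveDimensionLT (K.opcycles n) (d - k + 1) := by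
    induction k with
    | zero => exact fun n _ => hd _
    | succ k hk =>
      intro n hn
      push_cast at hn
      have hS := opcyclesSequence_shortExact (ha n (by lia))
      have := hk (n + 1) (by lia)
      have h₂ : Projective (opcyclesSequence K n).X₂ := inferInstanceAs (Projective (K.X (n + 1)))
      exact hS.hasProjectiveDimensionLT_X₁ _
        (hasProjectiveDimensionLT_of_ge _ 1 _ (by lia))
        (hasProjectiveDimensionLT_of_ge (K.opcycles (n + 1)) (d - k + 1) _ (by lia))
  have := key d n hn
  rw [Nat.sub_self] at this
  exact projective_iff_hasProjectiveDimensionLT_one.2 this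

lemma exists_isSplitAt_of_exactAt [∀ n, Projective (K.X n)] {a : ℤ} {d : ℕ}
    (ha : ∀ n < a, K.ExactAt n) (hd : ∀ X : C, HasProjectiveDimensionLE X d) :
    ∃ b : ℤ, ∀ n < b, K.IsSplitAt n := by
  refine ⟨a - d, fun n hn => ?_⟩
  have := projective_opcycles_of_exactAt ha hd (n + 1) (by lia)
  exact isSplitAt_of_projective_opcycles (ha n (by lia))

end CochainComplex

/-! ### A criterion for perfectness -/

section

variable {R : Type u} [Ring R]

lemma IsFGProjComplex.projective_X {K : CochainComplex (ModuleCat.{u} R) ℤ}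
    (hK : IsFGProjComplex R K) (n : ℤ) : Projective (K.X n) :=
  have := (hK n).2
  ModuleCat.projective_of_categoryTheory_projective _

lemma IsFGProjComplex.isKProjective {K : CochainComplex (ModuleCat.{u} R) ℤ}
    (hK : IsFGProjComplex R K) {b : ℤ} (hb : ∀ n > b, IsZero (K.X n)) : K.IsKProjective :=
  have := hK.projective_X
  have : K.IsStrictlyLE b := (K.isStrictlyLE_iff b).2 fun i hi => hb i hi
  K.isKProjective_of_projective b

lemma fgProj_of_retract {V W : ModuleCat.{u} R} (h : Retract V W)
    (hW : Module.Finite R W ∧ Module.Projective R W) :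
    Module.Finite R V ∧ Module.Projective R V := by
  have := hW.1
  have := hW.2
  have hr : h.r.hom ∘ₗ h.i.hom = LinearMap.id := ModuleCat.hom_ext_iff.1 h.retract
  exact ⟨Module.Finite.of_surjective h.r.hom (LinearMap.surjective_of_comp_eq_id _ _ hr),
    Module.Projective.of_split _ _ hr⟩

/-- A bounded above complex of finitely generated projective modules is perfect if it is split in
low degrees. -/
theorem isoClosure_kBoundedProj_of_isSplitAt {K : CochainComplex (ModuleCat.{u} R) ℤ}
    (hK : IsFGProjComplex R K) {b : ℤ} (hb : ∀ n > b, IsZero (K.X n)) {a : ℤ}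
    (ha : ∀ n < a, K.IsSplitAt n) :
    (kBoundedProj R).isoClosure ((HomotopyCategory.quotient _ _).obj K) := by
  -- The lowest term of the truncation is the opcycles at `a - 1`. Since `a - 1 < a`, the complex is
  -- split there, which makes this term a retract of `K.X (a - 1)`.
  let L := K.truncGE (a - 1)
  have hGE : K.IsGE (a - 1) := (K.isGE_iff _).2 fun i hi => (ha i (by lia)).exactAt
  have haL (n : ℤ) (hn : n < a - 1) : IsZero (L.X n) := L.isZero_of_isStrictlyGE (a - 1) n hn
  have hbL (n : ℤ) (hn : n > b) : IsZero (L.X n) :=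
    IsZero.of_epi ((HomologicalComplex.πTruncGE K (ComplexShape.embeddingUpIntGE (a - 1))).f n)
      (hb n hn)
  have hL : IsFGProjComplex R L := fun n => by
    refine fgProj_of_retract (Nonempty.some ?_) (hK n)
    obtain hn | rfl | hn := lt_trichotomy n (a - 1)
    · exact ⟨⟨0, 0, (haL n hn).eq_of_src _ _⟩⟩
    · obtain ⟨r⟩ := (ha (a - 1) (by lia)).nonempty_retract
      exact ⟨(K.truncGEXIsoOpcycles (a - 1)).retract.trans r⟩
    · exact ⟨(K.truncGEXIso (a - 1) n hn).retract⟩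
  -- The projection onto the truncation is a quasi-isomorphism between K-projective complexes, hence
  -- a homotopy equivalence.
  have := hK.isKProjective hb
  have := hL.isKProjective hbL
  have hπ : HomologicalComplex.homotopyEquivalences _ _ (K.πTruncGE (a - 1)) :=
    (CochainComplex.IsKProjective.quasiIso_iff _).1 inferInstance
  rw [← HomotopyCategory.inverseImage_quotient_isomorphisms] at hπ
  have : IsIso ((HomotopyCategory.quotient _ _).map (K.πTruncGE (a - 1))) :=
    (MorphismProperty.isomorphisms.iff _).1 hπ
  exact ⟨(HomotopyCategory.quotient _ _).obj L, ⟨hL, ⟨b, hbL⟩, a - 1, haL⟩,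
    ⟨asIso ((HomotopyCategory.quotient _ _).map (K.πTruncGE (a - 1)))⟩⟩

end

/-! ### Equivalences of Verdier quotients -/

namespace CategoryTheory.ObjectProperty

variable {C D : Type*} [Category* C] [Category* D]
  [HasShift C ℤ] [Preadditive C] [HasZeroObject C] [∀ n : ℤ, (shiftFunctor C n).Additive]
  [Pretriangulated C]
  [HasShift D ℤ] [Preadditive D] [HasZeroObject D] [∀ n : ℤ, (shiftFunctor D n).Additive]
  [Pretriangulated D]
  (P : ObjectProperty C) (Q : ObjectProperty D)

lemma trW_le_inverseImage (F : C ⥤ D) [F.CommShift ℤ] [F.IsTriangulated]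
    (hF : P ≤ Q.inverseImage F) : P.trW ≤ Q.trW.inverseImage F := by
  rintro X Y f ⟨Z, g, h, hT, hZ⟩
  exact trW.mk Q (F.map_distinguished _ hT) (hF _ hZ)

variable {P Q} in
-- Every morphism of the Verdier quotient is isomorphic to the image of a morphism of `C`, so being
-- triangulated can be tested after precomposition with the localization functor.
lemma isTriangulated_localizedFunctor [IsTriangulated C] [IsTriangulated D]
    [P.IsTriangulated] [Q.IsTriangulated] (Φ : LocalizerMorphism P.trW Q.trW)
    [Φ.functor.CommShift ℤ] [Φ.functor.IsTriangulated] :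
    (Φ.localizedFunctor P.trW.Q Q.trW.Q).IsTriangulated := by
  have : P.trW.Q.mapArrow.EssSurj := Localization.essSurj_mapArrow P.trW.Q P.trW
  let e := CatCommSq.iso Φ.functor P.trW.Q Q.trW.Q (Φ.localizedFunctor P.trW.Q Q.trW.Q)
  have : NatTrans.CommShift e.symm.hom ℤ := inferInstanceAs (NatTrans.CommShift e.inv ℤ)
  exact Functor.isTriangulated_of_precomp_iso e.symm

/-- Triangulated functors in opposite directions which preserve triangulated subcategories and are
mutually inverse up to natural morphisms whose cones belong to these subcategories induce a
triangle equivalence between the Verdier quotients. -/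
theorem exists_triangleEquivalence_localization [IsTriangulated C] [IsTriangulated D]
    [P.IsTriangulated] [Q.IsTriangulated]
    (F : C ⥤ D) [F.CommShift ℤ] [F.IsTriangulated] (G : D ⥤ C) [G.CommShift ℤ] [G.IsTriangulated]
    (hF : P ≤ Q.inverseImage F) (hG : Q ≤ P.inverseImage G)
    (ε : 𝟭 C ⟶ F ⋙ G) (hε : ∀ X, P.trW (ε.app X))
    (ε' : 𝟭 D ⟶ G ⋙ F) (hε' : ∀ X, Q.trW (ε'.app X)) :
    ∃ (e : P.trW.Localization ≌ Q.trW.Localization) (_ : e.functor.CommShift ℤ),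
      e.functor.IsTriangulated := by
  let Φ : LocalizerMorphism P.trW Q.trW := ⟨F, P.trW_le_inverseImage Q F hF⟩
  let Ψ : LocalizerMorphism Q.trW P.trW := ⟨G, Q.trW_le_inverseImage P G hG⟩
  let _ : Φ.functor.CommShift ℤ := ‹F.CommShift ℤ›
  have : Φ.functor.IsTriangulated := ‹F.IsTriangulated›
  have : Φ.IsLocalizedEquivalence :=
    Φ.isLocalizedEquivalence_of_unit_of_unit Ψ ε ε' hε hε'
  let H := Φ.localizedFunctor P.trW.Q Q.trW.Q
  exact ⟨H.asEquivalence, (inferInstance : H.CommShift ℤ), isTriangulated_localizedFunctor Φ⟩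

end CategoryTheory.ObjectProperty

-- Exactness and cohomology of complexes of modules.

lemma ModuleCat.exactAt_iff {R : Type u} [Ring R] (K : CochainComplex (ModuleCat.{u} R) ℤ)
    (n : ℤ) : K.ExactAt n ↔
      ∀ x : K.X n, K.d n (n + 1) x = 0 → ∃ y : K.X (n - 1), K.d (n - 1) n y = x := by
  rw [K.exactAt_iff' (n - 1) n (n + 1) (by simp) (by simp), ShortComplex.moduleCat_exact_iff]
  rfl

lemma isZero_homologyFunctor_iff {R : Type u} [Ring R]
    (K : HomotopyCategory (ModuleCat.{u} R) (ComplexShape.up ℤ)) (n : ℤ) :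
    IsZero ((HomotopyCategory.homologyFunctor (ModuleCat.{u} R) (ComplexShape.up ℤ) n).obj K) ↔
      K.as.ExactAt n := by
  rw [HomologicalComplex.exactAt_iff_isZero_homology]
  exact ((HomotopyCategory.homologyFunctorFactors (ModuleCat.{u} R)
    (ComplexShape.up ℤ) n).app K.as).isZero_iff

namespace TriangularMatrixRing

variable {T S M : Type u} [Ring T] [Ring S] [AddCommGroup M]
  [Module S M] [Module Tᵐᵒᵖ M] [SMulCommClass S Tᵐᵒᵖ M]

/-! ### The trace of a complex -/

section

variable (K : CochainComplex (ModuleCat.{u} (TriangularMatrixRing T S M)) ℤ)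

/-- The complex of corners of a complex. -/
noncomputable abbrev cornerComplex : CochainComplex (ModuleCat.{u} T) ℤ :=
  ((cornerFunctor T S M).mapHomologicalComplex _).obj K

/-- The complex of submodules generated by the corners of a complex. -/
noncomputable abbrev traceComplex : CochainComplex (ModuleCat.{u} (TriangularMatrixRing T S M)) ℤ :=
  ((traceFunctor T S M).mapHomologicalComplex _).obj K

/-- The complex of quotients by the submodules generated by the corners of a complex. -/
noncomputable abbrev quotientComplex :
    CochainComplex (ModuleCat.{u} (TriangularMatrixRing T S M)) ℤ :=
  ((inflation T S M).mapHomologicalComplex _).obj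
    (((quotientFunctor T S M).mapHomologicalComplex _).obj K)

/-- The projection of a complex onto its quotient by the trace. -/
noncomputable def toQuotientComplex : K ⟶ quotientComplex K where
  f n := (quotientπ T S M).app (K.X n)
  comm' _ _ _ := ((quotientπ T S M).naturality _).symm

variable {K} in
lemma toQuotientComplex_naturality
    {L : CochainComplex (ModuleCat.{u} (TriangularMatrixRing T S M)) ℤ} (f : K ⟶ L) :
    f ≫ toQuotientComplex L = toQuotientComplex K ≫
      ((inflation T S M).mapHomologicalComplex _).map
        (((quotientFunctor T S M).mapHomologicalComplex _).map f) := by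
  ext1 n
  exact (quotientπ T S M).naturality (f.f n)

variable (T M) in
/-- The projection of an inflated complex onto its quotient by the trace. -/
noncomputable def inflationQuotientComplexHom (N : CochainComplex (ModuleCat.{u} S) ℤ) :
    N ⟶ ((quotientFunctor T S M).mapHomologicalComplex _).obj
      (((inflation T S M).mapHomologicalComplex _).obj N) where
  f n := (inflationQuotientHom T S M).app (N.X n)
  comm' _ _ _ := ((inflationQuotientHom T S M).naturality _).symm

variable (T M) in
lemma inflationQuotientComplexHom_naturality {N L : CochainComplex (ModuleCat.{u} S) ℤ}
    (f : N ⟶ L) :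
    f ≫ inflationQuotientComplexHom T M L = inflationQuotientComplexHom T M N ≫
      ((quotientFunctor T S M).mapHomologicalComplex _).map
        (((inflation T S M).mapHomologicalComplex _).map f) := by
  ext1 n
  exact (inflationQuotientHom T S M).naturality (f.f n)

instance (N : CochainComplex (ModuleCat.{u} S) ℤ) : IsIso (inflationQuotientComplexHom T M N) :=
  have (n : ℤ) : IsIso ((inflationQuotientComplexHom T M N).f n) :=
    inferInstanceAs (IsIso ((inflationQuotientHom T S M).app (N.X n)))
  HomologicalComplex.Hom.isIso_of_components _

/-- The degreewise split short exact sequence formed by the trace of a complex, the complex, and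
the quotient. -/
noncomputable abbrev traceComplexSequence :
    ShortComplex (CochainComplex (ModuleCat.{u} (TriangularMatrixRing T S M)) ℤ) where
  X₁ := traceComplex K
  X₂ := K
  X₃ := quotientComplex K
  f := { f n := (traceι T S M).app (K.X n), comm' _ _ _ := ((traceι T S M).naturality _).symm }
  g := toQuotientComplex K
  zero := by
    ext1 n
    exact (traceSequence (K.X n)).zero

variable {K}

/-- Passing to corners is exact: if `y` is a preimage of an element of the corner, so is `e y`. -/
lemma exactAt_cornerComplex {n : ℤ} (h : K.ExactAt n) : (cornerComplex K).ExactAt n := by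
  rw [ModuleCat.exactAt_iff] at h ⊢
  intro (x : corner T S M (K.X n)) hx
  obtain ⟨y, hy⟩ := h x (congr_arg Subtype.val hx)
  refine ⟨toCorner T S M y, Subtype.ext ?_⟩
  change (K.d (n - 1) n).hom (inT S M (1 : T) • y) = x
  rw [map_smul]
  exact (congr_arg (inT S M (1 : T) • ·) hy).trans x.2

/-- The two contracting maps extend linearly from the corners to the terms of `K`. The homotopy
identity holds for the extensions on the corner, hence on its span, the trace. -/
lemma isSplitAt_traceComplex (hK : IsFGProjComplex _ K) {n : ℤ}
    (h : (cornerComplex K).IsSplitAt n) : (traceComplex K).IsSplitAt n := by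
  obtain ⟨h, h', H⟩ := h
  have := (hK n).2
  have := (hK (n + 1)).2
  obtain ⟨ψ, hψ⟩ := exists_extend_corner (T := T) (S := S) (M := M)
    (V := K.X n) (W := K.X (n - 1)) h.hom
  obtain ⟨ψ', hψ'⟩ := exists_extend_corner (T := T) (S := S) (M := M)
    (V := K.X (n + 1)) (W := K.X n) h'.hom
  refine ⟨(traceFunctor T S M).map (ModuleCat.ofHom ψ),
    (traceFunctor T S M).map (ModuleCat.ofHom ψ'), ?_⟩
  let θ : K.X n →ₗ[TriangularMatrixRing T S M] K.X n :=
    (K.d (n - 1) n).hom ∘ₗ ψ + ψ' ∘ₗ (K.d n (n + 1)).hom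
  have hθ : Set.EqOn θ (LinearMap.id (R := TriangularMatrixRing T S M))
      (corner T S M (K.X n) : Set (K.X n)) := fun x hx => by
    have h₁ := congr_arg Subtype.val (ConcreteCategory.congr_hom H (⟨x, hx⟩ : corner T S M (K.X n)))
    have h₂ := congr_arg (K.d (n - 1) n) (hψ ⟨x, hx⟩)
    have h₃ := hψ' (cornerMap (K.d n (n + 1)).hom ⟨x, hx⟩)
    exact (congr_arg₂ (· + ·) h₂ h₃).trans h₁
  ext (x : trace T S M (K.X n))
  exact Subtype.ext (LinearMap.eqOn_span hθ x.2)

lemma isFGProjComplex_traceComplex (hK : IsFGProjComplex _ K) :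
    IsFGProjComplex _ (traceComplex K) := fun n =>
  have := (hK n).1
  have := (hK n).2
  trace_fg_projective (K.X n)

/-- The trace of a bounded above complex of finitely generated projective modules with bounded
cohomology is perfect if the upper left entry has finite global dimension. -/
theorem isoClosure_kBoundedProj_traceComplex (hT : FiniteLeftGlobalDimension T)
    (hK : IsFGProjComplex _ K) {b : ℤ} (hb : ∀ n > b, IsZero (K.X n))
    {a : ℤ} (ha : ∀ n < a, K.ExactAt n) :
    (kBoundedProj (TriangularMatrixRing T S M)).isoClosure
      ((HomotopyCategory.quotient _ _).obj (traceComplex K)) := by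
  obtain ⟨d, hd⟩ := hT
  have (n : ℤ) : Projective ((cornerComplex K).X n) :=
    have := (hK n).2
    have := projective_corner (T := T) (S := S) (M := M) (V := K.X n)
    ModuleCat.projective_of_categoryTheory_projective (ModuleCat.of T (corner T S M (K.X n)))
  obtain ⟨c, hc⟩ := CochainComplex.exists_isSplitAt_of_exactAt (K := cornerComplex K)
    (fun n hn => exactAt_cornerComplex (ha n hn)) hd
  exact isoClosure_kBoundedProj_of_isSplitAt (isFGProjComplex_traceComplex hK)
    (fun n hn => (traceFunctor T S M).map_isZero (hb n hn))
    (fun n hn => isSplitAt_traceComplex hK (hc n hn))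

lemma trW_toQuotientComplex (hK : IsFGProjComplex _ K)
    (h : (kBoundedProj (TriangularMatrixRing T S M)).isoClosure
      ((HomotopyCategory.quotient _ _).obj (traceComplex K))) :
    (kBoundedProj (TriangularMatrixRing T S M)).isoClosure.trW
      ((HomotopyCategory.quotient _ _).map (toQuotientComplex K)) := by
  have := fun n => (hK n).2
  let σ (n : ℤ) : ((traceComplexSequence K).map (HomologicalComplex.eval _ _ n)).Splitting :=
    traceSequenceSplitting (K.X n)
  -- A degreewise split sequence gives a distinguished triangle, in which the cone of the second map
  -- is a shift of the first term, the trace complex.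
  exact (ObjectProperty.trW_iff_of_distinguished' _ _
    (HomotopyCategory.distinguished_iff_iso_trianglehOfDegreewiseSplit _ |>.2
      ⟨_, σ, ⟨Iso.refl _⟩⟩)).2 h

end

/-! ### The induced functors on homotopy categories -/

variable (T S M) in
/-- The functor induced by `quotientFunctor` on homotopy categories. -/
noncomputable abbrev quotientHomotopyFunctor :
    HomotopyCategory (ModuleCat.{u} (TriangularMatrixRing T S M)) (ComplexShape.up ℤ) ⥤
      HomotopyCategory (ModuleCat.{u} S) (ComplexShape.up ℤ) :=
  (quotientFunctor T S M).mapHomotopyCategory _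

variable (T S M) in
/-- The functor induced by `inflation` on homotopy categories. -/
noncomputable abbrev inflationHomotopyFunctor :
    HomotopyCategory (ModuleCat.{u} S) (ComplexShape.up ℤ) ⥤
      HomotopyCategory (ModuleCat.{u} (TriangularMatrixRing T S M)) (ComplexShape.up ℤ) :=
  (inflation T S M).mapHomotopyCategory _

variable (T S M) in
/-- The projection of a complex onto its quotient by the trace, in the homotopy category. -/
noncomputable def homotopyUnit :
    𝟭 _ ⟶ quotientHomotopyFunctor T S M ⋙ inflationHomotopyFunctor T S M where
  app K := (HomotopyCategory.quotient _ _).map (toQuotientComplex K.as)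
  naturality := by
    rintro K L f
    obtain ⟨f : K.as ⟶ L.as, rfl⟩ := (HomotopyCategory.quotient _ _).map_surjective f
    exact ((HomotopyCategory.quotient _ _).map_comp _ _).symm.trans
      ((congr_arg _ (toQuotientComplex_naturality f)).trans
        ((HomotopyCategory.quotient _ _).map_comp _ _))

variable (T S M) in
/-- The quotient of an inflated complex is the complex itself, in the homotopy category. -/
noncomputable def inflationQuotientHomotopyHom :
    𝟭 _ ⟶ inflationHomotopyFunctor T S M ⋙ quotientHomotopyFunctor T S M where
  app K := (HomotopyCategory.quotient _ _).map (inflationQuotientComplexHom T M K.as)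
  naturality := by
    rintro K L f
    obtain ⟨f : K.as ⟶ L.as, rfl⟩ := (HomotopyCategory.quotient _ _).map_surjective f
    exact ((HomotopyCategory.quotient _ _).map_comp _ _).symm.trans
      ((congr_arg _ (inflationQuotientComplexHom_naturality T M f)).trans
        ((HomotopyCategory.quotient _ _).map_comp _ _))

instance (K : HomotopyCategory (ModuleCat.{u} S) (ComplexShape.up ℤ)) :
    IsIso ((inflationQuotientHomotopyHom T S M).app K) :=
  (HomotopyCategory.quotient _ _).map_isIso (inflationQuotientComplexHom T M K.as)

/-! ### Preservation of finiteness conditions -/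

lemma isFGProjComplex_quotient {K : CochainComplex (ModuleCat.{u} (TriangularMatrixRing T S M)) ℤ}
    (hK : IsFGProjComplex _ K) :
    IsFGProjComplex S (((quotientFunctor T S M).mapHomologicalComplex _).obj K) := fun n =>
  have := (hK n).1
  have := (hK n).2
  ⟨TraceQuotient.finite T S M (K.X n), TraceQuotient.projective T S M (K.X n)⟩

variable (T M) in
lemma isFGProjComplex_inflation {K : CochainComplex (ModuleCat.{u} S) ℤ}
    (hK : IsFGProjComplex _ K) :
    IsFGProjComplex (TriangularMatrixRing T S M)
      (((inflation T S M).mapHomologicalComplex _).obj K) := fun n =>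
  have := (hK n).1
  have := (hK n).2
  ⟨finite_inflation T S M (K.X n), projective_inflation T S M (K.X n)⟩

variable (T M) in
lemma exactAt_inflation_iff (K : CochainComplex (ModuleCat.{u} S) ℤ) (n : ℤ) :
    HomologicalComplex.ExactAt (((inflation T S M).mapHomologicalComplex _).obj K) n ↔
      K.ExactAt n := by
  rw [ModuleCat.exactAt_iff, ModuleCat.exactAt_iff]
  rfl

lemma kBoundedProj_quotient : kBoundedProj (TriangularMatrixRing T S M) ≤
    (kBoundedProj S).inverseImage (quotientHomotopyFunctor T S M) :=
  fun _ ⟨hK, ⟨b, hb⟩, a, ha⟩ => ⟨isFGProjComplex_quotient hK,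
    ⟨b, fun n hn => (quotientFunctor T S M).map_isZero (hb n hn)⟩,
    a, fun n hn => (quotientFunctor T S M).map_isZero (ha n hn)⟩

lemma kBoundedProj_inflation : kBoundedProj S ≤
    (kBoundedProj (TriangularMatrixRing T S M)).inverseImage (inflationHomotopyFunctor T S M) :=
  fun _ ⟨hK, ⟨b, hb⟩, a, ha⟩ => ⟨isFGProjComplex_inflation T M hK,
    ⟨b, fun n hn => (inflation T S M).map_isZero (hb n hn)⟩,
    a, fun n hn => (inflation T S M).map_isZero (ha n hn)⟩

lemma kMinusBoundedProj_inflation : kMinusBoundedProj S ≤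
    (kMinusBoundedProj (TriangularMatrixRing T S M)).inverseImage
      (inflationHomotopyFunctor T S M) := by
  rintro K ⟨⟨a, b', h⟩, hK, b, hb⟩
  refine ⟨⟨a, b', fun n hn => ?_⟩, isFGProjComplex_inflation T M hK,
    b, fun n hn => (inflation T S M).map_isZero (hb n hn)⟩
  have := h n hn
  rw [isZero_homologyFunctor_iff] at this ⊢
  exact (exactAt_inflation_iff T M K.as n).2 this

lemma boundedCohomology_of_isoClosure_kBoundedProj {R : Type u} [Ring R] :
    (kBoundedProj R).isoClosure ≤ boundedCohomology R := by
  rw [ObjectProperty.isoClosure_le_iff]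
  rintro K ⟨_, ⟨b, hb⟩, a, ha⟩
  refine ⟨a, b, fun n hn => ?_⟩
  rw [isZero_homologyFunctor_iff]
  exact ShortComplex.exact_of_isZero_X₂ _ (hn.elim (ha n) (hb n))

/-- The projection onto the quotient by the trace has a perfect cone. -/
theorem trW_homotopyUnit (hT : FiniteLeftGlobalDimension T)
    {K : HomotopyCategory (ModuleCat.{u} (TriangularMatrixRing T S M)) (ComplexShape.up ℤ)}
    (hK : kMinusBoundedProj _ K) :
    (kBoundedProj (TriangularMatrixRing T S M)).isoClosure.trW
      ((homotopyUnit T S M).app K) := by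
  obtain ⟨⟨a, b', h⟩, hK, b, hb⟩ := hK
  exact trW_toQuotientComplex hK (isoClosure_kBoundedProj_traceComplex hT hK hb (a := a)
    fun n hn => (isZero_homologyFunctor_iff K n).1 (h n (Or.inl hn)))

/-- The quotient functor is not exact in general, so bounded cohomology is not preserved formally.
It follows from the triangle on `K`, its inflated quotient and a perfect cone, because inflation
leaves cohomology unchanged as groups. -/
lemma kMinusBoundedProj_quotient (hT : FiniteLeftGlobalDimension T) :
    kMinusBoundedProj (TriangularMatrixRing T S M) ≤
      (kMinusBoundedProj S).inverseImage (quotientHomotopyFunctor T S M) := by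
  intro K hK
  obtain ⟨Z, g, h, hT, hZ⟩ := trW_homotopyUnit hT hK
  obtain ⟨hK₁, hK₂, b, hb⟩ := hK
  have : boundedCohomology _ ((inflationHomotopyFunctor T S M).obj
      ((quotientHomotopyFunctor T S M).obj K)) :=
    (boundedCohomology (TriangularMatrixRing T S M)).ext_of_isTriangulatedClosed₂ _ hT hK₁
      (boundedCohomology_of_isoClosure_kBoundedProj _ hZ)
  obtain ⟨a, b', h⟩ := this
  refine ⟨⟨a, b', fun n hn => ?_⟩, isFGProjComplex_quotient hK₂,
    b, fun n hn => (quotientFunctor T S M).map_isZero (hb n hn)⟩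
  have := h n hn
  rw [isZero_homologyFunctor_iff] at this ⊢
  exact (exactAt_inflation_iff T M _ n).1 this

/-! ### The singular equivalence -/

/-- The functor induced by `quotientFunctor` on complexes with bounded cohomology. -/
noncomputable abbrev kMinusBoundedQuotient (hT : FiniteLeftGlobalDimension T) :
    (kMinusBoundedProj (TriangularMatrixRing T S M)).FullSubcategory ⥤
      (kMinusBoundedProj S).FullSubcategory :=
  (kMinusBoundedProj S).lift
    ((kMinusBoundedProj (TriangularMatrixRing T S M)).ι ⋙ quotientHomotopyFunctor T S M)
    fun K => kMinusBoundedProj_quotient hT _ K.property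

variable (T S M) in
/-- The functor induced by `inflation` on complexes with bounded cohomology. -/
noncomputable abbrev kMinusBoundedInflation :
    (kMinusBoundedProj S).FullSubcategory ⥤
      (kMinusBoundedProj (TriangularMatrixRing T S M)).FullSubcategory :=
  (kMinusBoundedProj (TriangularMatrixRing T S M)).lift
    ((kMinusBoundedProj S).ι ⋙ inflationHomotopyFunctor T S M)
    fun K => kMinusBoundedProj_inflation _ K.property

noncomputable instance (hT : FiniteLeftGlobalDimension T) :
    (kMinusBoundedQuotient (S := S) (M := M) hT).CommShift ℤ :=
  Functor.CommShift.ofComp (ObjectProperty.liftCompιIso _ _ _) ℤ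

instance (hT : FiniteLeftGlobalDimension T) :
    (kMinusBoundedQuotient (S := S) (M := M) hT).IsTriangulated :=
  ObjectProperty.isTriangulated_lift _ _ _

noncomputable instance : (kMinusBoundedInflation T S M).CommShift ℤ :=
  Functor.CommShift.ofComp (ObjectProperty.liftCompιIso _ _ _) ℤ

instance : (kMinusBoundedInflation T S M).IsTriangulated :=
  ObjectProperty.isTriangulated_lift _ _ _

/-- If the upper left entry has finite global dimension, the triangular matrix ring is singularly
equivalent to its lower right entry. -/
theorem singularlyEquivalent (hT : FiniteLeftGlobalDimension T) :
    SingularlyEquivalent (TriangularMatrixRing T S M) S := by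
  let ε : 𝟭 _ ⟶ kMinusBoundedQuotient hT ⋙ kMinusBoundedInflation T S M :=
    { app K := ObjectProperty.homMk ((homotopyUnit T S M).app K.obj)
      naturality K L f := by
        ext1
        exact (homotopyUnit T S M).naturality f.hom }
  let ε' : 𝟭 _ ⟶ kMinusBoundedInflation T S M ⋙ kMinusBoundedQuotient hT :=
    { app K := ObjectProperty.homMk ((inflationQuotientHomotopyHom T S M).app K.obj)
      naturality K L f := by
        ext1
        exact (inflationQuotientHomotopyHom T S M).naturality f.hom }
  have hε (K) : (perfectComplexes (TriangularMatrixRing T S M)).trW (ε.app K) := by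
    -- Perfectness of the cone is tested in the ambient homotopy category.
    rw [ObjectProperty.inverseImage_trW_iff]
    exact trW_homotopyUnit hT K.property
  have hε' (K) : (perfectComplexes S).trW (ε'.app K) := by
    rw [ObjectProperty.inverseImage_trW_iff]
    have : IsIso ((kMinusBoundedProj S).ι.map (ε'.app K)) :=
      inferInstanceAs (IsIso ((inflationQuotientHomotopyHom T S M).app K.obj))
    exact ObjectProperty.trW_of_isIso _ _
  refine ObjectProperty.exists_triangleEquivalence_localization _ _
    (kMinusBoundedQuotient hT) (kMinusBoundedInflation T S M) ?_ ?_ ε hε ε' hε'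
  · rintro K ⟨L, hL, ⟨e⟩⟩
    exact ⟨_, kBoundedProj_quotient _ hL, ⟨(quotientHomotopyFunctor T S M).mapIso e⟩⟩
  · rintro K ⟨L, hL, ⟨e⟩⟩
    exact ⟨_, kBoundedProj_inflation _ hL, ⟨(inflationHomotopyFunctor T S M).mapIso e⟩⟩

end TriangularMatrixRing

-- Fields and the main theorem.

lemma finiteLeftGlobalDimension_of_field (k : Type u) [Field k] : FiniteLeftGlobalDimension k :=
  ⟨0, fun X =>
    have : Module.Free k X := Module.Free.of_divisionRing k X
    have : Module.Projective k X := Module.Projective.of_free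
    (projective_iff_hasProjectiveDimensionLE_zero X).1
      (ModuleCat.projective_of_categoryTheory_projective X)⟩

theorem mainTheorem3 :
    (∀ (T S M : Type u) [Ring T] [Ring S] [AddCommGroup M] [Module S M] [Module Tᵐᵒᵖ M]
        [SMulCommClass S Tᵐᵒᵖ M] [IsNoetherianRing T] [IsNoetherianRing S] [Module.Finite S M],
        FiniteLeftGlobalDimension T →
          IsNoetherianRing (TriangularMatrixRing T S M) ∧
            SingularlyEquivalent (TriangularMatrixRing T S M) S) ∧
    (∀ (k Λ M : Type u) [Field k] [Ring Λ] [Algebra k Λ] [AddCommGroup M] [Module Λ M]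
        [Module k M] [IsScalarTower k Λ M] [Module.Finite k Λ] [Module.Finite k M],
        IsNoetherianRing (OnePointExtension k Λ M) ∧
          SingularlyEquivalent (OnePointExtension k Λ M) Λ) := by
  have main : ∀ (T S M : Type u) [Ring T] [Ring S] [AddCommGroup M] [Module S M] [Module Tᵐᵒᵖ M]
      [SMulCommClass S Tᵐᵒᵖ M] [IsNoetherianRing T] [IsNoetherianRing S] [Module.Finite S M],
      FiniteLeftGlobalDimension T →
        IsNoetherianRing (TriangularMatrixRing T S M) ∧
          SingularlyEquivalent (TriangularMatrixRing T S M) S := by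
    intro T S M _ _ _ _ _ _ _ _ _ hT
    exact ⟨TriangularMatrixRing.isNoetherianRing T S M,
      TriangularMatrixRing.singularlyEquivalent hT⟩
  refine ⟨main, ?_⟩
  intro k Λ M _ _ _ _ _ _ _ _ _
  -- These structures repeat those in the ring instance on `OnePointExtension`, so that it agrees
  -- definitionally with the triangular matrix ring.
  let _ : Module kᵐᵒᵖ M :=
    Module.compHom M ((RingHom.id k).fromOpposite (fun x y => mul_comm x y))
  let _ : IsCentralScalar k M := ⟨fun _ _ => rfl⟩
  let _ : SMulCommClass Λ k M := IsScalarTower.to_smulCommClass'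
  have : IsNoetherianRing Λ := isNoetherian_of_tower k inferInstance
  have : Module.Finite Λ M := Module.Finite.of_restrictScalars_finite k Λ M
  exact main k Λ M (finiteLeftGlobalDimension_of_field k)
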